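/- **Notation.** For integers $N\ge 0$, $n\ge 1$ let $(N)_n$ be the remainder of $N$ on division by $n$ and $(N,n)$ the greatest common divisor. A cyclic code $C$ of length $n\ge 1$ over the finite field $\mathbb F_q$, where $(n,q)=1$, is an ideal of $\mathbb F_q[x]/(x^n-1)$; its words $c=(c_0,\dots,c_{n-1})\in\mathbb F_q^n$ are identified with $c_0+c_1x+\dots+c_{n-1}x^{n-1}$. Let $g_C$ be its generator polynomial (the monic divisor of $x^n-1$ that generates it) and, for a fixed primitive $n$-th root of unity $\alpha$ in an extension field of $\mathbb F_q$, let $S_C=\{i : 0\le i\le n-1,\ g_C(\alpha^i)=0\}$ be its defining set. The distance $d$ of $C\neq 0$ is the minimum Hamming weight of its non-zero words. Let $\mathcal U=\{0,\Delta^+,\Delta\}$ be a set of three symbols. Vectors over $\mathcal U$ are concatenated by juxtaposition, and $\mathbf b^k$ denotes the concatenation of $k$ copies of $\mathbf b$. Let $R(n,S_C)\in\mathcal U^n$ be the vector $(u_0,\dots,u_{n-1})$ with $u_i=0$ if $i\in S_C$ and $u_i=\Delta$ otherwise. For $\mathbf v\in\mathcal U^N$ let $\mathcal A(\mathbf v)$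 be the set of all $\mathbf u\in\{0,\Delta^+\}^N$, $\mathbf u\ne(0,\dots,0)$, such that $u_i=0$ whenever $v_i=0$ and $u_i=\Delta^+$ whenever $v_i=\Delta^+$. For $\mathbf u\in\mathcal U^M$ and $\mathbf v\in\mathcal U^N$ with $M\le N$, write $\mathbf u\preccurlyeq\mathbf v$ ($\mathbf u$ is included in $\mathbf v$) if there is a cyclic shift $(v'_1,\dots,v'_N)$ of $\mathbf v$ with $\mathcal A((v'_1,\dots,v'_M))\subseteq\mathcal A(\mathbf u)$. **Theorem (bound C).** Let $C\neq 0$ be a cyclic code of length $n$ over $\mathbb F_q$, $(n,q)=1$, with defining set $S_C$ and distance $d$. Suppose that there are integers $\ell,m,r,s,\rho\geq 0$ with $1\le m\le \ell$, $s\ge 1$, $\rho\ge 1$ such that $$(0^\ell\Delta^r)(0^m\Delta^r)^s\preccurlyeq R(n,S_C)^\rho\qquad\text{or}\qquad(\Delta^r0^m)^s(\Delta^r0^\ell)\preccurlyeq R(n,S_C)^\rho .$$ Then: - if $(m+r,n)\le m$, then $\displaystyle d\ \ge\ \ell+1+s-r\left\lfloor\frac{\ell}{m+r}\right\rfloor-\max\{(\ell)_{m+r}-m,\,0\}$;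 - otherwise, $d\ge \ell+1$. Moreover, in the particular case that $\ell=\lambda\mu$, $m=\mu-1$, $r=1$ and $s\ge\lambda+1$ for some integers $\lambda,\mu\ge 0$, we also have: - $d\ge\mu\lambda+\mu+s-\lambda-1$, if $\mu\nmid n$; - $d\ge\mu\lambda+\mu$, if $\mu\mid n$. -/

import Mathlib

open Polynomial

namespace CyclicBound

/-! ### Cyclic codes -/

section Codes

variable {F : Type*} [Field F] {n : ℕ}

/-- The ring `R_n = F[x] / (x^n - 1)`. A cyclic code of length `n` over `F` is an ideal of it. -/
abbrev CyclicRing (F : Type*) [Field F] (n : ℕ) : Type _ :=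
  F[X] ⧸ Ideal.span {(X ^ n - 1 : F[X])}

/-- The element of `R_n` identified with the word `(c_0, …, c_{n-1})`, namely the class of
`c_0 + c_1 x + ⋯ + c_{n-1} x^{n-1}`. -/
noncomputable def wordClass (c : Fin n → F) : CyclicRing F n :=
  Ideal.Quotient.mk _ (∑ i : Fin n, Polynomial.C (c i) * X ^ (i : ℕ))

/-- The words `c ∈ F^n` of the cyclic code `C`. -/
def words (C : Ideal (CyclicRing F n)) : Set (Fin n → F) :=
  {c | wordClass c ∈ C}

open Classical in
/-- Hamming weight: the number of non-zero coordinates. -/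
noncomputable def weight (c : Fin n → F) : ℕ := hammingNorm c

/-- The distance of `C`: the minimum weight of its non-zero words
(meaningful when `C` is not the zero code). -/
noncomputable def distance (C : Ideal (CyclicRing F n)) : ℕ :=
  sInf {w | ∃ c ∈ words C, c ≠ 0 ∧ weight c = w}

/-- A generator of the (principal) ideal of `F[x]` of all polynomials whose class lies in `C`. -/
noncomputable def preGenerator (C : Ideal (CyclicRing F n)) : F[X] :=
  Submodule.IsPrincipal.generator
    (C.comap (Ideal.Quotient.mk (Ideal.span {(X ^ n - 1 : F[X])})))

/-- The generator polynomial `g_C`: the monic generator of that ideal. It divides `x^n - 1`. -/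
noncomputable def generatorPoly (C : Ideal (CyclicRing F n)) : F[X] :=
  Polynomial.C (preGenerator C).leadingCoeff⁻¹ * preGenerator C

/-- The (complete) defining set `S_C = {i | g_C(α^i) = 0, 0 ≤ i ≤ n - 1}` of `C` with respect
to `α`. -/
def definingSet {E : Type*} [Field E] [Algebra F E] (C : Ideal (CyclicRing F n)) (α : E) :
    Set ℕ :=
  {i | i < n ∧ aeval (α ^ i) (generatorPoly C) = 0}

end Codes

/-! ### Vectors over the three symbols `0`, `Δ⁺`, `Δ`; a vector is a list of symbols -/

/-- The symbols: `zero` is an element known to be zero, `plus` (`Δ⁺`) an element known to be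
non-zero, `delta` (`Δ`) an element about which nothing is known. -/
inductive USym : Type
  | zero
  | plus
  | delta

/-- `USym.Refines a b`: a coordinate `b` is allowed, in an element of `𝒜(v)`, at a place where
`v` has the symbol `a`. -/
def USym.Refines : USym → USym → Prop
  | .zero, b => b = .zero
  | .plus, b => b = .plus
  | .delta, b => b = .plus ∨ b = .zero

/-- `𝒜(v)`: the vectors `u`, of the same length as `v` and not the zero vector, with `u[i] = 0`
where `v[i] = 0`, with `u[i] = Δ⁺` where `v[i] = Δ⁺`, and with `u[i] ∈ {Δ⁺, 0}` where
`v[i] = Δ`. -/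
def specializations (v : List USym) : Set (List USym) :=
  {u | List.Forall₂ USym.Refines v u ∧ u ≠ List.replicate v.length USym.zero}

/-- Inclusion `u ≼ v` of a vector `u` of length `m` in a vector `v` of length `n ≥ m`: for some
cyclic shift `v'` of `v`, the truncation of `v'` to its first `m` coordinates satisfies
`𝒜(v'_1, …, v'_m) ⊆ 𝒜(u)`. -/
def Included (u v : List USym) : Prop :=
  u.length ≤ v.length ∧
    ∃ i < v.length, specializations ((v.rotate i).take u.length) ⊆ specializations u

/-- The block `(b)^k`: the concatenation of `k` copies of the vector `b`. -/
def pow (b : List USym) (k : ℕ) : List USym := (List.replicate k b).flatten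

/-- The block `(0)^k`. -/
def zeros (k : ℕ) : List USym := pow [USym.zero] k

/-- The block `(Δ)^k`. -/
def deltas (k : ℕ) : List USym := pow [USym.delta] k

open Classical in
/-- `R(n, S) = (u_0, …, u_{n-1})`, with `u_i = 0` if `i ∈ S` and `u_i = Δ` otherwise. -/
noncomputable def rootVector (n : ℕ) (S : Set ℕ) : List USym :=
  (List.range n).map fun i => if i ∈ S then USym.zero else USym.delta

end CyclicBound

/-! Take a non-zero word c of minimum weight, put γ_i = c_i and β_i = α^i for i in its support, and
set A(k) = ∑ γ_i β_i^k = c(α^k). The number of terms is d, and A vanishes on the defining set.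
Pairing the row (β_i^a) with the column (γ_i β_i^b) gives A(a + b), so every Hankel-type matrix with
entries A(a + b) has rank at most d. The theorem comes from exhibiting enough independent rows.

Rows are of two kinds (`card_add_le_card`). Pivot rows form a triangular system, with the first
non-zero value A(z) on the diagonal and the zeros before it on one side. Further rows, in
progression of step p = m + r, vanish on all pivot columns because of the repeated zero blocks.
These are independent among themselves: a linear relation would be a recurrence of step p for A,
which would propagate the zero blocks forever, and gcd(p, n) ≤ m would then force A = 0
(`progression_independent`).

`general_bound` uses as pivot columns the residues below m modulo p. The special case uses a
two-parameter pivot system ordered lexicographically (`lex_bound`). The pattern with the long block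
last is reduced to the other one by replacing β with its inverse. -/

namespace CyclicBound

/-! ### Exponential sums and linear independence -/

section ExpSum

variable {E ι : Type*} [Field E] [Fintype ι]

/-- The two-sided sequence `k ↦ ∑ i, γ i * β i ^ k`. -/
def expSum (γ β : ι → E) (k : ℤ) : E := ∑ i, γ i * β i ^ k

theorem expSum_add (γ β : ι → E) (hβ : ∀ i, β i ≠ 0) (a k : ℤ) :
    expSum (fun i => γ i * β i ^ a) β k = expSum γ β (a + k) := by
  unfold expSum
  refine Finset.sum_congr rfl fun i _ => ?_
  rw [zpow_add₀ (hβ i), mul_assoc]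

theorem expSum_sub (γ β : ι → E) (hβ : ∀ i, β i ≠ 0) (a k : ℤ) :
    expSum (fun i => γ i * β i ^ a) (fun i => (β i)⁻¹) k = expSum γ β (a - k) := by
  unfold expSum
  refine Finset.sum_congr rfl fun i _ => ?_
  rw [sub_eq_add_neg, zpow_add₀ (hβ i), mul_assoc, inv_zpow, zpow_neg]

theorem expSum_periodic (γ β : ι → E) (hβ : ∀ i, β i ≠ 0) {n : ℕ} (hn : ∀ i, β i ^ n = 1) :
    Function.Periodic (expSum γ β) (n : ℤ) := by
  intro k
  unfold expSum
  refine Finset.sum_congr rfl fun i _ => ?_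
  rw [zpow_add₀ (hβ i), zpow_natCast, hn, mul_one]

/-- A triangular system of rows, together with `N` rows in arithmetic progression vanishing on the
pivot columns, is linearly independent as soon as the progression is. -/
theorem card_add_le_card (γ β : ι → E) (hβ : ∀ i, β i ≠ 0)
    {κ : Type*} [Fintype κ] [LinearOrder κ] (row col : κ → ℤ) (N : ℕ) (e p : ℤ)
    (hpivot : ∀ g, expSum γ β (row g + col g) ≠ 0)
    (hlower : ∀ g g', g' < g → expSum γ β (row g + col g') = 0)
    (hprog : ∀ j : Fin N, ∀ g, expSum γ β (e + (j : ℕ) * p + col g) = 0)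
    (hindep : ∀ x : Fin N → E,
      (∀ k, ∑ j, x j * expSum γ β (k + (j : ℕ) * p) = 0) → ∀ j, x j = 0) :
    Fintype.card κ + N ≤ Fintype.card ι := by
  let v : κ ⊕ Fin N → ι → E :=
    Sum.elim (fun g i => β i ^ row g) (fun j i => β i ^ (e + (j : ℕ) * p))
  have hv : LinearIndependent E v := by
    rw [Fintype.linearIndependent_iff]
    intro x hx
    -- Pair the relation with the column (γ_i β_i^k).
    have key : ∀ k : ℤ, (∑ g, x (Sum.inl g) * expSum γ β (row g + k)) +
        ∑ j : Fin N, x (Sum.inr j) * expSum γ β (e + (j : ℕ) * p + k) = 0 := by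
      intro k
      have h : ∑ i, γ i * β i ^ k * (∑ a, x a • v a) i = 0 := by rw [hx]; simp
      rw [← h]
      simp only [Fintype.sum_sum_type, Finset.sum_apply, Pi.smul_apply, smul_eq_mul,
        mul_add, Finset.sum_add_distrib, Finset.mul_sum, expSum, v, Sum.elim_inl, Sum.elim_inr]
      congr 1
      · rw [Finset.sum_comm]
        refine Finset.sum_congr rfl fun i _ => Finset.sum_congr rfl fun g _ => ?_
        rw [zpow_add₀ (hβ i)]; ring
      · rw [Finset.sum_comm]
        refine Finset.sum_congr rfl fun i _ => Finset.sum_congr rfl fun g _ => ?_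
        rw [zpow_add₀ (hβ i) _ k]; ring
    -- Forward substitution: in column `col g` the later pivot rows and the whole progression
    -- vanish, and the earlier coefficients are already zero.
    have hl : ∀ g, x (Sum.inl g) = 0 := by
      intro g
      induction g using WellFoundedLT.induction with
      | ind g ih =>
        have h := key (col g)
        rw [Finset.sum_eq_zero (s := (Finset.univ : Finset (Fin N)))
          (fun j _ => by rw [hprog j g, mul_zero]), add_zero,
          Finset.sum_eq_single g] at h
        · exact (mul_eq_zero.mp h).resolve_right (hpivot g)
        · intro g' _ hne
          rcases lt_or_gt_of_ne hne with h' | h'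
          · rw [ih g' h', zero_mul]
          · rw [hlower g' g h', mul_zero]
        · simp
    have hr := hindep (fun j => x (Sum.inr j)) (fun k => by
      have h := key (k - e)
      simp only [hl, zero_mul, Finset.sum_const_zero, zero_add] at h
      rw [← h]
      refine Finset.sum_congr rfl fun j _ => ?_
      congr 2; ring)
    rintro (g | j)
    · exact hl g
    · exact hr j
  simpa using hv.fintype_card_le_finrank

end ExpSum

/-! ### Sequences vanishing on repeated blocks -/

section Sequences

variable {E : Type*} [Field E]

/-- By Bézout the multiples of p cover all multiples of gcd(p, n) modulo n, so translates of a block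
at least that long cover every residue. -/
theorem eq_zero_of_blocks {A : ℤ → E} {n p m : ℕ} (hn : 1 ≤ n)
    (hA : Function.Periodic A (n : ℤ)) (hg : Nat.gcd p n ≤ m) (e : ℤ)
    (h : ∀ j b : ℕ, b < m → A (e + j * p + b) = 0) (k : ℤ) : A k = 0 := by
  have hgpos : 0 < Nat.gcd p n := Nat.gcd_pos_of_pos_right _ hn
  have hgz : (0 : ℤ) < (Nat.gcd p n : ℤ) := by exact_mod_cast hgpos
  have hbez := Nat.gcd_eq_gcd_ab p n
  set u := Nat.gcdA p n
  set v := Nat.gcdB p n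
  set g : ℤ := (Nat.gcd p n : ℤ)
  set q := (k - e) / g
  obtain ⟨b, hb⟩ := Int.eq_ofNat_of_zero_le (Int.emod_nonneg (k - e) hgz.ne')
  have hbm : b < m := by
    have := Int.emod_lt_of_pos (k - e) hgz
    omega
  have hnz : (n : ℤ) ≠ 0 := by omega
  obtain ⟨j, hj⟩ := Int.eq_ofNat_of_zero_le (Int.emod_nonneg (u * q) hnz)
  have h1 := Int.emod_add_mul_ediv (k - e) g
  have h2 := Int.emod_add_mul_ediv (u * q) n
  set w := (u * q) / (n : ℤ)
  have hk : k = (e + j * p + b) + (w * p + v * q) * n := by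
    rw [hb] at h1
    rw [hj] at h2
    have h3 : g * q = p * (u * q) + n * v * q := by rw [hbez]; ring
    rw [← h2] at h3
    change (b : ℤ) + g * q = k - e at h1
    linear_combination h3 - h1
  have h4 := hA.int_mul (w * p + v * q) (e + j * p + b)
  rw [Int.cast_id] at h4
  rw [hk, h4]
  exact h j b hbm

/-- The last non-zero coefficient x_J expresses each term through the J preceding ones along the
progression. -/
theorem forall_eq_zero_of_recurrence {A : ℤ → E} {N : ℕ} {p : ℤ} (x : Fin N → E)
    (hx : ∀ k, ∑ j, x j * A (k + (j : ℕ) * p) = 0) (J : Fin N) (hJ : x J ≠ 0)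
    (hJmax : ∀ j, J < j → x j = 0) (k : ℤ) (h : ∀ j : ℕ, j < J → A (k + j * p) = 0) (j : ℕ) :
    A (k + j * p) = 0 := by
  induction j using Nat.strong_induction_on with
  | _ j ih =>
    by_cases hj : j < J
    · exact h j hj
    · have h1 := hx (k + ((j - J : ℕ) : ℤ) * p)
      rw [Finset.sum_eq_single J] at h1
      · have h2 := (mul_eq_zero.mp h1).resolve_left hJ
        have h3 : ((j - J : ℕ) : ℤ) = j - (J : ℕ) := by omega
        rw [h3] at h2
        convert h2 using 2
        ring
      · intro i _ hne
        rcases lt_or_gt_of_ne hne with h' | h'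
        · have h2 := ih (j - J + i) (by have : (i : ℕ) < J := h'; omega)
          have h3 : ((j - J + i : ℕ) : ℤ) = ((j - J : ℕ) : ℤ) + (i : ℕ) := by push_cast; ring
          rw [h3, add_mul, ← add_assoc] at h2
          rw [h2, mul_zero]
        · rw [hJmax i h', zero_mul]
      · simp

/-- N rows need only N − 1 zero blocks, since the recurrence given by a relation has order at most N
− 1. -/
theorem progression_independent {A : ℤ → E} {n p m N : ℕ} (hn : 1 ≤ n)
    (hA : Function.Periodic A (n : ℤ)) (hne : ∃ k, A k ≠ 0) (hg : Nat.gcd p n ≤ m) (e : ℤ)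
    (h : ∀ j b : ℕ, j + 1 < N → b < m → A (e + j * p + b) = 0) (x : Fin N → E)
    (hx : ∀ k, ∑ j, x j * A (k + (j : ℕ) * p) = 0) (j : Fin N) : x j = 0 := by
  classical
  by_contra hj
  obtain ⟨k, hk⟩ := hne
  obtain ⟨J, hJ, hmax⟩ := (Finset.univ.filter fun j => x j ≠ 0).exists_max_image id
    ⟨j, by simpa using hj⟩
  refine hk (eq_zero_of_blocks hn hA hg e (fun i b hb => ?_) k)
  have h1 := forall_eq_zero_of_recurrence x hx J (by simpa using hJ)
    (fun i hi => by
      by_contra h0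
      exact absurd (hmax i (by simpa using h0)) (not_le.mpr hi)) (e + b)
    (fun i hi => by
      rw [add_right_comm]
      exact h i b (by omega) hb) i
  rwa [add_right_comm]

end Sequences

/-! ### Lower bounds for the number of terms of an exponential sum -/

section Bounds

variable {E ι : Type*} [Field E] [Fintype ι] {γ β : ι → E} {n : ℕ}

theorem exists_first_ne_zero {A : ℤ → E} (hn : 1 ≤ n) (hA : Function.Periodic A (n : ℤ))
    (hne : ∃ k, A k ≠ 0) : ∃ z : ℕ, A z ≠ 0 ∧ ∀ k : ℤ, 0 ≤ k → k < z → A k = 0 := by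
  classical
  have h : ∃ z : ℕ, A z ≠ 0 := by
    obtain ⟨k, hk⟩ := hne
    obtain ⟨z, hz⟩ := Int.eq_ofNat_of_zero_le (Int.emod_nonneg k (b := (n : ℤ)) (by omega))
    refine ⟨z, ?_⟩
    have h1 := Int.emod_add_mul_ediv k n
    rw [hz] at h1
    have h2 := hA.int_mul (k / n) z
    rw [Int.cast_id, mul_comm, h1] at h2
    rwa [← h2]
  refine ⟨Nat.find h, Nat.find_spec h, fun k hk hkz => ?_⟩
  lift k to ℕ using hk
  simpa using Nat.find_min h (m := k) (by exact_mod_cast hkz)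

/-- The BCH bound: the rows z − g against the columns g, for 0 ≤ g ≤ z, are triangular with diagonal
A(z). -/
theorem succ_le_card_of_first_ne_zero (hβ : ∀ i, β i ≠ 0) {z : ℕ} (hz : expSum γ β z ≠ 0)
    (hlt : ∀ k : ℤ, 0 ≤ k → k < z → expSum γ β k = 0) : z + 1 ≤ Fintype.card ι := by
  have h := card_add_le_card γ β hβ (κ := Fin (z + 1)) (fun g => z - (g : ℕ)) (fun g => (g : ℕ))
    0 0 0 (fun g => by simpa using hz)
    (fun g g' hg => hlt _ (by have : (g : ℕ) < z + 1 := g.2; omega)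
      (by have : (g' : ℕ) < g := hg; omega))
    (fun j => j.elim0) (fun x _ j => j.elim0)
  simpa using h

theorem count_mod_lt_mul {p m : ℕ} (hmp : m ≤ p) (a t : ℕ) (ht : t ≤ p) :
    Nat.count (fun c => c % p < m) (a * p + t) = a * m + min t m := by
  have base : ∀ t ≤ p, Nat.count (fun c => c % p < m) t = min t m := by
    intro t
    induction t with
    | zero => simp
    | succ t ih =>
      intro h
      rw [Nat.count_succ, ih (by omega), Nat.mod_eq_of_lt (by omega : t < p)]
      split_ifs <;> omega
  induction a with
  | zero => simpa using base t ht
  | succ a ih =>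
    have h1 : (a + 1) * p + t = p + (a * p + t) := by ring
    rw [h1, Nat.count_add, base p le_rfl]
    simp only [Nat.add_mod_left]
    rw [ih]
    have : (a + 1) * m = a * m + m := by ring
    omega

/-- The pivot columns are the c ≤ ℓ with c mod p < m, where p = m + r. Adding a multiple of p to
such a column stays inside the zero blocks if the start is aligned with them. The first two summands
count these columns, the last one the progression rows. -/
theorem general_bound (hβ : ∀ i, β i ≠ 0) (hn : 1 ≤ n) (hA : Function.Periodic (expSum γ β) (n : ℤ))
    (hne : ∃ k, expSum γ β k ≠ 0) {ℓ m r s : ℕ} (hm : 1 ≤ m) (hmℓ : m ≤ ℓ)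
    (h0 : ∀ k : ℤ, 0 ≤ k → k < ℓ → expSum γ β k = 0)
    (h1 : ∀ j b : ℕ, j < s → b < m → expSum γ β (ℓ + r + j * ((m + r : ℕ) : ℤ) + b) = 0)
    (hg : Nat.gcd (m + r) n ≤ m) :
    ℓ / (m + r) * m + min (ℓ % (m + r) + 1) m + (if ℓ % (m + r) < m then s else s + 1) ≤
      Fintype.card ι := by
  classical
  obtain ⟨z, hz, hlt⟩ := exists_first_ne_zero hn hA hne
  have hzℓ : ℓ ≤ z := by
    by_contra h
    exact hz (h0 z (by omega) (by omega))
  obtain ⟨p, hp⟩ : ∃ p, p = m + r := ⟨_, rfl⟩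
  rw [← hp] at h1 hg ⊢
  have hdiv : ℓ / p * p + ℓ % p = ℓ := Nat.div_add_mod' ℓ p
  have htp : ℓ % p < p := Nat.mod_lt _ (by omega)
  set a := ℓ / p
  set t := ℓ % p
  -- If t ≥ m, one more block fits at the start of the initial run, at t + r − p = t − m ≥ 0, and
  -- gives one more progression row.
  obtain ⟨δ, hδ⟩ : ∃ δ, δ = if t < m then 0 else 1 := ⟨_, rfl⟩
  have hN : (if t < m then s else s + 1) = s + δ := by rw [hδ]; split_ifs <;> rfl
  have hstart : (0 : ℤ) ≤ t + r - δ * p := by rw [hδ]; split_ifs <;> push_cast <;> omega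
  rw [hN]
  have hblock : ∀ (i b : ℕ), i < s + a + δ → b < m →
      expSum γ β ((t + r - δ * p : ℤ) + i * p + b) = 0 := by
    intro i b hi hb
    by_cases hia : i < a + δ
    · refine h0 _ (by positivity) ?_
      have h3 : ((i : ℤ) + 1) * p ≤ (a + δ) * p :=
        mul_le_mul_of_nonneg_right (by omega) (by positivity)
      zify at hdiv
      have h4 : (b : ℤ) < m := by exact_mod_cast hb
      have h5 : (p : ℤ) = m + r := by exact_mod_cast hp
      nlinarith
    · have h3 := h1 (i - (a + δ)) b (by omega) hb
      have h4 : ((i - (a + δ) : ℕ) : ℤ) = i - (a + δ) := by omega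
      rw [h4] at h3
      zify at hdiv
      convert h3 using 2
      linear_combination hdiv
  have h := card_add_le_card γ β hβ (κ := {c // c ∈ (Finset.range (ℓ + 1)).filter (· % p < m)})
    (fun g => z - (g : ℕ)) (fun g => (g : ℕ)) (s + δ) (t + r - δ * p) p
    (fun g => by simpa using hz)
    (fun g g' hgg => hlt _
      (by have := g.2; simp only [Finset.mem_filter, Finset.mem_range] at this; omega)
      (by have : (g' : ℕ) < g := hgg; omega))
    (fun j g => by
      have hgm := g.2
      simp only [Finset.mem_filter, Finset.mem_range] at hgm
      have hga : (g : ℕ) / p ≤ a := Nat.div_le_div_right (by omega)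
      have h3 := hblock (j + (g : ℕ) / p) ((g : ℕ) % p) (by have := j.2; omega) hgm.2
      have h4 : (g : ℕ) / p * p + (g : ℕ) % p = g := Nat.div_add_mod' _ p
      zify at h4
      convert h3 using 2
      push_cast
      linear_combination -h4)
    -- The start is ℓ − m: the last m zeros of the initial run serve as block 0, ahead of the s
    -- blocks of the pattern.
    (progression_independent hn hA hne hg ((ℓ : ℤ) + r - p) (fun j b hj hb => by
      have hδ1 : δ ≤ 1 := by rw [hδ]; split_ifs <;> omega
      rcases j with _ | j
      · refine h0 _ ?_ ?_ <;> push_cast <;> omega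
      · have h3 := h1 j b (by omega) hb
        convert h3 using 2
        push_cast
        ring))
  rw [Fintype.card_coe, ← Nat.count_eq_card_filter_range] at h
  have hc := count_mod_lt_mul (p := p) (m := m) (by omega) a (t + 1) htp
  rw [← add_assoc, hdiv] at hc
  omega

/-- For pivots (e, c) and (e', c') the entry is A((λ − c + c')μ + e − e'). If e' < e the argument is
not a multiple of μ; if e' = e and c' < c it is a multiple below λμ. When progression rows are
present, M < μ keeps their offsets μ − 1 − e positive. -/
theorem lex_bound (hβ : ∀ i, β i ≠ 0) {lam μ M J N : ℕ} (hM : M ≤ μ)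
    (hJ : 2 * lam + 1 ≤ J) (hN : N = 0 ∨ M < μ ∧ N + lam ≤ J)
    (h0 : ∀ k : ℤ, 0 ≤ k → k < (lam * μ : ℕ) → expSum γ β k = 0)
    (hz : expSum γ β (lam * μ : ℕ) ≠ 0)
    (h1 : ∀ j b : ℕ, j < J → 0 < b → b < μ → expSum γ β (j * μ + b) = 0)
    (hindep : ∀ x : Fin N → E,
      (∀ k, ∑ j, x j * expSum γ β (k + (j : ℕ) * (μ : ℤ)) = 0) → ∀ j, x j = 0) :
    M * (lam + 1) + N ≤ Fintype.card ι := by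
  have h := card_add_le_card γ β hβ (κ := Fin M ×ₗ Fin (lam + 1))
    (fun g => ((lam : ℤ) - ((ofLex g).2 : ℕ)) * μ + ((ofLex g).1 : ℕ))
    (fun g => ((ofLex g).2 : ℕ) * (μ : ℤ) - ((ofLex g).1 : ℕ)) N ((μ : ℤ) - 1) μ
    (fun g => by
      convert hz using 2
      push_cast; ring)
    (fun g g' hgg => by
      have hc := (ofLex g).2.2
      have hc' := (ofLex g').2.2
      have he := (ofLex g).1.2
      rcases Prod.Lex.lt_iff.mp hgg with h' | ⟨he', h'⟩
      · have h3 : ((ofLex g').1 : ℕ) < (ofLex g).1 := h'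
        have h4 := h1 (lam - (ofLex g).2 + (ofLex g').2) ((ofLex g).1 - (ofLex g').1)
          (by omega) (by omega) (by omega)
        rw [Nat.cast_add, Nat.cast_sub (by omega), Nat.cast_sub h3.le] at h4
        convert h4 using 2
        ring
      · have h3 : ((ofLex g').2 : ℕ) < (ofLex g).2 := h'
        rw [he']
        have h5 : ((lam : ℤ) - ((ofLex g).2 : ℕ)) * μ + ((ofLex g).1 : ℕ) +
            (((ofLex g').2 : ℕ) * (μ : ℤ) - ((ofLex g).1 : ℕ)) =
            ((lam : ℤ) - ((ofLex g).2 : ℕ) + ((ofLex g').2 : ℕ)) * μ := by ring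
        rw [h5]
        refine h0 _ (mul_nonneg (by omega) (by positivity)) ?_
        push_cast
        exact mul_lt_mul_of_pos_right (by omega) (by omega))
    (fun j g => by
      have hc := (ofLex g).2.2
      have he := (ofLex g).1.2
      have hj := j.2
      have h4 := h1 (j + (ofLex g).2) (μ - 1 - (ofLex g).1) (by omega) (by omega) (by omega)
      rw [Nat.cast_add, Nat.cast_sub (by omega), Nat.cast_sub (by omega)] at h4
      convert h4 using 2
      push_cast; ring)
    hindep
  simpa [Fintype.card_lex] using h

end Bounds
-- The case ℓ = λμ, m = μ − 1, r = 1, and the bounds combined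
section SpecialBounds

variable {E ι : Type*} [Field E] [Fintype ι] {γ β : ι → E} {n : ℕ}

theorem eq_zero_of_not_dvd {A : ℤ → E} {lam m s : ℕ}
    (h0 : ∀ k : ℤ, 0 ≤ k → k < (lam * (m + 1) : ℕ) → A k = 0)
    (h1 : ∀ j b : ℕ, j < s → b < m →
      A ((lam * (m + 1) : ℕ) + (1 : ℕ) + j * ((m + 1 : ℕ) : ℤ) + b) = 0)
    (j b : ℕ) (hj : j < lam + s) (hb : 0 < b) (hbm : b < m + 1) :
    A (j * ((m + 1 : ℕ) : ℤ) + b) = 0 := by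
  by_cases hjl : j < lam
  · refine h0 _ (by positivity) ?_
    have : (j + 1) * (m + 1) ≤ lam * (m + 1) := Nat.mul_le_mul_right _ hjl
    have h : j * (m + 1) + b < lam * (m + 1) := by linarith
    exact_mod_cast h
  · have h := h1 (j - lam) (b - 1) (by omega) (by omega)
    rw [Nat.cast_sub (by omega), Nat.cast_sub (by omega)] at h
    convert h using 2
    push_cast; ring

/-- Within the pattern only multiples of m + 1 can carry non-zero values. A first non-zero value
beyond it is so late that the BCH bound suffices. -/
theorem first_ne_zero_cases {A : ℤ → E} {lam m J z : ℕ} (hz : A z ≠ 0)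
    (h0 : ∀ k : ℤ, 0 ≤ k → k < (lam * (m + 1) : ℕ) → A k = 0)
    (h1 : ∀ j b : ℕ, j < J → 0 < b → b < m + 1 → A (j * ((m + 1 : ℕ) : ℤ) + b) = 0) :
    J * (m + 1) ≤ z ∨ ∃ k, lam ≤ k ∧ k < J ∧ z = k * (m + 1) := by
  have hzl : lam * (m + 1) ≤ z := by
    by_contra h
    exact hz (h0 z (by omega) (by exact_mod_cast not_le.mp h))
  by_cases hJ : z / (m + 1) < J
  · right
    have hd := Nat.div_add_mod' z (m + 1)
    refine ⟨z / (m + 1), (Nat.le_div_iff_mul_le (by omega)).mpr hzl, hJ, ?_⟩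
    by_contra hne
    refine hz ?_
    have h := h1 (z / (m + 1)) (z % (m + 1)) hJ (by omega) (Nat.mod_lt _ (by omega))
    rw [← hd]
    push_cast at h ⊢
    exact h
  · left
    exact (Nat.le_div_iff_mul_le (by omega)).mp (not_lt.mp hJ)

theorem special_bound (hβ : ∀ i, β i ≠ 0) (hn : 1 ≤ n)
    (hA : Function.Periodic (expSum γ β) (n : ℤ)) (hne : ∃ k, expSum γ β k ≠ 0) {lam m s : ℕ}
    (hs : lam + 1 ≤ s)
    (h0 : ∀ k : ℤ, 0 ≤ k → k < (lam * (m + 1) : ℕ) → expSum γ β k = 0)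
    (h1 : ∀ j b : ℕ, j < lam + s → 0 < b → b < m + 1 →
      expSum γ β (j * ((m + 1 : ℕ) : ℤ) + b) = 0) :
    (m + 1) * (lam + 1) ≤ Fintype.card ι := by
  obtain ⟨z, hz, hlt⟩ := exists_first_ne_zero hn hA hne
  have hb := succ_le_card_of_first_ne_zero hβ hz hlt
  rcases first_ne_zero_cases hz h0 h1 with h | ⟨k, hk, hkJ, rfl⟩
  · have : (lam + 1) * (m + 1) ≤ (lam + s) * (m + 1) := Nat.mul_le_mul_right _ (by omega)
    linarith
  · rcases hk.eq_or_lt with rfl | hk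
    · exact lex_bound (N := 0) hβ le_rfl (by omega) (Or.inl rfl) h0 hz h1 (fun x _ j => j.elim0)
    · have : (lam + 1) * (m + 1) ≤ k * (m + 1) := Nat.mul_le_mul_right _ hk
      linarith

/-- With the first non-zero value at k(m + 1), `lex_bound` is applied to k in place of λ. Each unit
of k − λ costs one progression row but gains m ≥ 1 pivots. -/
theorem special_bound_of_not_dvd (hβ : ∀ i, β i ≠ 0) (hn : 1 ≤ n)
    (hA : Function.Periodic (expSum γ β) (n : ℤ)) (hne : ∃ k, expSum γ β k ≠ 0) {lam m s : ℕ}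
    (hm : 1 ≤ m) (hs : lam + 1 ≤ s) (hdvd : ¬ (m + 1) ∣ n)
    (h0 : ∀ k : ℤ, 0 ≤ k → k < (lam * (m + 1) : ℕ) → expSum γ β k = 0)
    (h1 : ∀ j b : ℕ, j < lam + s → 0 < b → b < m + 1 →
      expSum γ β (j * ((m + 1 : ℕ) : ℤ) + b) = 0) :
    m * (lam + 1) + s ≤ Fintype.card ι := by
  obtain ⟨z, hz, hlt⟩ := exists_first_ne_zero hn hA hne
  have hb := succ_le_card_of_first_ne_zero hβ hz hlt
  have hg : Nat.gcd (m + 1) n ≤ m := by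
    have h2 : Nat.gcd (m + 1) n ≤ m + 1 := Nat.gcd_le_left _ (by omega)
    have h3 : Nat.gcd (m + 1) n ≠ m + 1 := fun h => hdvd (Nat.gcd_eq_left_iff_dvd.mp h)
    omega
  rcases first_ne_zero_cases hz h0 h1 with h | ⟨k, hk, hkJ, rfl⟩
  · nlinarith
  · obtain ⟨u, rfl⟩ := Nat.exists_eq_add_of_le hk
    obtain ⟨v, rfl⟩ := Nat.exists_eq_add_of_le hm
    by_cases hJ : 2 * (lam + u) + 1 ≤ lam + s
    · have h2 := lex_bound (M := 1 + v) (N := lam + s - (lam + u)) hβ (Nat.le_succ _) hJ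
        (Or.inr ⟨Nat.lt_succ_self _, by omega⟩) hlt hz h1
        (progression_independent hn hA hne hg 1 (fun j b hj hb => by
          have h3 := h1 j (b + 1) (by omega) (by omega) (by omega)
          convert h3 using 2
          push_cast; ring))
      obtain ⟨w, rfl⟩ := Nat.exists_eq_add_of_le (show u ≤ s by omega)
      have h4 : lam + (u + w) - (lam + u) = w := by omega
      rw [h4] at h2
      nlinarith
    -- Now s ≤ λ + 2u, and the BCH bound `hb` is enough; s ≥ λ + 1 excludes u = 0.
    · obtain ⟨w, rfl⟩ := Nat.exists_eq_add_of_le (show 1 ≤ u by omega)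
      nlinarith

/-- The bounds for an exponential sum whose zeros contain the pattern `0^ℓ Δ^r (0^m Δ^r)^s`. -/
theorem pattern_bounds (hβ : ∀ i, β i ≠ 0) (hβn : ∀ i, β i ^ n = 1) (hn : 1 ≤ n)
    (hne : ∃ k, expSum γ β k ≠ 0) {ℓ m r s : ℕ} (hm : 1 ≤ m) (hmℓ : m ≤ ℓ)
    (h0 : ∀ k : ℤ, 0 ≤ k → k < ℓ → expSum γ β k = 0)
    (h1 : ∀ j b : ℕ, j < s → b < m → expSum γ β (ℓ + r + j * ((m + r : ℕ) : ℤ) + b) = 0) :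
    (Nat.gcd (m + r) n ≤ m →
      (Fintype.card ι : ℤ) ≥ (ℓ : ℤ) + 1 + s - r * ((ℓ / (m + r) : ℕ) : ℤ)
        - max (((ℓ % (m + r) : ℕ) : ℤ) - m) 0) ∧
    (¬ Nat.gcd (m + r) n ≤ m → Fintype.card ι ≥ ℓ + 1) ∧
    (∀ lam μ : ℕ, ℓ = lam * μ → m + 1 = μ → lam + 1 ≤ s → r = 1 →
      (¬ μ ∣ n → (Fintype.card ι : ℤ) ≥ (μ : ℤ) * lam + μ + s - lam - 1) ∧
      (μ ∣ n → Fintype.card ι ≥ μ * lam + μ)) := by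
  have hA := expSum_periodic γ β hβ hβn
  refine ⟨fun hg => ?_, fun _ => ?_, ?_⟩
  · have h := general_bound hβ hn hA hne hm hmℓ h0 h1 hg
    have hd := Nat.div_add_mod' ℓ (m + r)
    generalize ℓ / (m + r) = a at *
    generalize ℓ % (m + r) = t at *
    have hd' : (a : ℤ) * m + r * a + t = ℓ := by rw [← hd]; push_cast; ring
    have h' : (a : ℤ) * m + ((min (t + 1) m + (if t < m then s else s + 1) : ℕ) : ℤ) ≤
        Fintype.card ι := by exact_mod_cast (by omega)
    split_ifs at h' with htm
    · rw [max_eq_right (by omega)]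
      omega
    · rw [max_eq_left (by omega)]
      omega
  · obtain ⟨z, hz, hlt⟩ := exists_first_ne_zero hn hA hne
    have hb := succ_le_card_of_first_ne_zero hβ hz hlt
    have hzℓ : ℓ ≤ z := by
      by_contra h
      exact hz (h0 z (by omega) (by omega))
    omega
  · rintro lam μ rfl rfl hs rfl
    have h2 := eq_zero_of_not_dvd h0 h1
    refine ⟨fun hdvd => ?_, fun _ => ?_⟩
    · have h := special_bound_of_not_dvd hβ hn hA hne hm hs hdvd h0 h2
      zify at h
      push_cast
      linarith
    · have h := special_bound hβ hn hA hne hs h0 h2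
      linarith

end SpecialBounds

/-! ### The symbol patterns -/

section Patterns

/-- Turning every Δ of the truncated shift into Δ⁺ gives a specialization whose zeros are exactly
those of the truncation. If it is the zero vector, the truncation is itself all zeros and the claim
is immediate. -/
theorem exists_forall_eq_zero_of_included {u v : List USym} (h : Included u v) :
    ∃ i < v.length, ∀ j : ℕ, u[j]? = some USym.zero →
      v[(i + j) % v.length]? = some USym.zero := by
  obtain ⟨hlen, i, hi, hsub⟩ := h
  refine ⟨i, hi, fun j hj => ?_⟩
  have hju : j < u.length := (List.getElem?_eq_some_iff.mp hj).1
  set t := (v.rotate i).take u.length with ht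
  have htlen : t.length = u.length := by simp [ht, hlen]
  have htj : t[j]? = v[(i + j) % v.length]? := by
    rw [ht, List.getElem?_take_of_lt hju, List.getElem?_rotate (by omega), add_comm]
  rw [← htj]
  let f : USym → USym := fun a => match a with
    | .zero => .zero
    | .plus => .plus
    | .delta => .plus
  have hf0 : ∀ a, f a = .zero → a = .zero := by rintro (_ | _ | _) h <;> simp_all [f]
  have hf : ∀ a, USym.Refines a (f a) := by rintro (_ | _ | _) <;> simp [f, USym.Refines]
  have hft : t[j]?.map f = some .zero := by
    rw [← List.getElem?_map]
    by_cases hz : t.map f = List.replicate t.length .zero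
    · rw [hz, List.getElem?_replicate, if_pos (by omega)]
    · have hmem : t.map f ∈ specializations t := by
        refine ⟨?_, hz⟩
        rw [List.forall₂_map_right_iff]
        exact List.forall₂_same.mpr fun a _ => hf a
      have h2 := (hsub hmem).1
      have h3 := h2.get hju (by simpa [htlen] using hju)
      have h4 : u.get ⟨j, hju⟩ = .zero := by
        simpa [List.getElem?_eq_getElem hju] using hj
      rw [h4] at h3
      rw [List.getElem?_eq_getElem (by simpa [htlen] using hju)]
      exact congrArg some h3
  obtain ⟨a, ha, hfa⟩ := Option.map_eq_some_iff.mp hft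
  rw [ha, hf0 a hfa]

theorem pow_succ_eq (b : List USym) (k : ℕ) : pow b (k + 1) = b ++ pow b k := by
  simp [pow, List.replicate_succ]

theorem length_pow (b : List USym) (k : ℕ) : (pow b k).length = k * b.length := by
  induction k with
  | zero => simp [pow]
  | succ k ih => rw [pow_succ_eq, List.length_append, ih]; ring

theorem getElem?_pow (b : List USym) {k q x : ℕ} (hq : q < k) (hx : x < b.length) :
    (pow b k)[q * b.length + x]? = b[x]? := by
  induction k generalizing q with
  | zero => omega
  | succ k ih =>
    rw [pow_succ_eq]
    rcases q with _ | q
    · rw [List.getElem?_append_left (by omega)]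
      simp
    · have h1 : (q + 1) * b.length + x = b.length + (q * b.length + x) := by ring
      rw [h1, List.getElem?_append_right (by omega), Nat.add_sub_cancel_left]
      exact ih (by omega)

theorem length_zeros (k : ℕ) : (zeros k).length = k := by simp [zeros, length_pow]

theorem length_deltas (k : ℕ) : (deltas k).length = k := by simp [deltas, length_pow]

theorem getElem?_zeros {k x : ℕ} (hx : x < k) : (zeros k)[x]? = some USym.zero := by
  simpa [zeros] using getElem?_pow [USym.zero] hx (x := 0) (by simp)

theorem getElem?_pow_rootVector {n : ℕ} (hn : 1 ≤ n) (S : Set ℕ) {ρ x : ℕ}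
    (h : (pow (rootVector n S) ρ)[x]? = some USym.zero) : x % n ∈ S := by
  have hlen : (rootVector n S).length = n := by simp [rootVector]
  have hx : x < ρ * n := by
    have := (List.getElem?_eq_some_iff.mp h).1
    rwa [length_pow, hlen] at this
  have hmod : x % n < n := Nat.mod_lt _ hn
  have h1 := getElem?_pow (rootVector n S) (k := ρ) (q := x / n) (x := x % n)
    ((Nat.div_lt_iff_lt_mul (by omega)).mpr hx) (by omega)
  rw [hlen, Nat.div_add_mod', h] at h1
  by_contra hS
  simp [rootVector, List.getElem?_range hmod, hS] at h1

theorem exists_shift_of_included {n : ℕ} (hn : 1 ≤ n) {S : Set ℕ} {ρ : ℕ} {u : List USym}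
    (h : Included u (pow (rootVector n S) ρ)) :
    ∃ i : ℕ, ∀ j : ℕ, u[j]? = some USym.zero → (i + j) % n ∈ S := by
  obtain ⟨i, hi, hz⟩ := exists_forall_eq_zero_of_included h
  refine ⟨i, fun j hj => ?_⟩
  have h1 := getElem?_pow_rootVector hn S (hz j hj)
  rwa [length_pow, show (rootVector n S).length = n by simp [rootVector],
    Nat.mod_mul_left_mod] at h1

theorem getElem?_forward_head {ℓ r : ℕ} (w : List USym) {k : ℕ} (hk : k < ℓ) :
    ((zeros ℓ ++ deltas r) ++ w)[k]? = some USym.zero := by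
  rw [List.append_assoc, List.getElem?_append_left (by rwa [length_zeros]), getElem?_zeros hk]

theorem getElem?_forward_block {ℓ m r s j b : ℕ} (hj : j < s) (hb : b < m) :
    ((zeros ℓ ++ deltas r) ++ pow (zeros m ++ deltas r) s)[ℓ + r + j * (m + r) + b]? =
      some USym.zero := by
  have hl : (zeros ℓ ++ deltas r).length = ℓ + r := by simp [length_zeros, length_deltas]
  have hl' : (zeros m ++ deltas r).length = m + r := by simp [length_zeros, length_deltas]
  rw [List.getElem?_append_right (by omega), hl,
    show ℓ + r + j * (m + r) + b - (ℓ + r) = j * (m + r) + b by omega]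
  have h := getElem?_pow (zeros m ++ deltas r) hj (x := b) (by omega)
  rw [hl'] at h
  rw [h, List.getElem?_append_left (by rwa [length_zeros]), getElem?_zeros hb]

theorem getElem?_backward_head {ℓ m r s k : ℕ} (hk : k < ℓ) :
    (pow (deltas r ++ zeros m) s ++ (deltas r ++ zeros ℓ))[s * (m + r) + r + k]? =
      some USym.zero := by
  have hl : (pow (deltas r ++ zeros m) s).length = s * (m + r) := by
    simp [length_pow, length_zeros, length_deltas, add_comm]
  rw [List.getElem?_append_right (by omega), hl,
    show s * (m + r) + r + k - s * (m + r) = r + k by omega,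
    List.getElem?_append_right (by rw [length_deltas]; omega), length_deltas,
    Nat.add_sub_cancel_left, getElem?_zeros hk]

theorem getElem?_backward_block {m r s j b : ℕ} (w : List USym) (hj : j < s) (hb : b < m) :
    (pow (deltas r ++ zeros m) s ++ w)[j * (m + r) + r + b]? = some USym.zero := by
  have hl : (deltas r ++ zeros m).length = m + r := by
    simp [length_zeros, length_deltas, add_comm]
  have h := getElem?_pow (deltas r ++ zeros m) hj (x := r + b) (by omega)
  rw [hl, ← add_assoc, List.getElem?_append_right (by rw [length_deltas]; omega), length_deltas,
    Nat.add_sub_cancel_left, getElem?_zeros hb] at h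
  rw [List.getElem?_append_left (List.getElem?_eq_some_iff.mp h).1, h]

end Patterns

/-! ### Words of a cyclic code as exponential sums -/

section Words

variable {F : Type*} [Field F] {n : ℕ}

theorem exists_word_ne_zero (hn : 1 ≤ n) {C : Ideal (CyclicRing F n)} (hC : C ≠ ⊥) :
    ∃ c ∈ words C, c ≠ 0 := by
  obtain ⟨x, hx, hx0⟩ := Submodule.exists_mem_ne_zero_of_ne_bot hC
  obtain ⟨f, rfl⟩ := Ideal.Quotient.mk_surjective x
  have hmonic : (X ^ n - 1 : F[X]).Monic := monic_X_pow_sub_C 1 (by omega)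
  have hdeg : (f %ₘ (X ^ n - 1)).natDegree < n := by
    have h := natDegree_modByMonic_lt f hmonic (by
      intro h
      have h2 : (X ^ n - 1 : F[X]).natDegree = n := natDegree_X_pow_sub_C (r := (1 : F))
      rw [h, natDegree_one] at h2
      omega)
    rwa [show (X ^ n - 1 : F[X]).natDegree = n from natDegree_X_pow_sub_C (r := (1 : F))] at h
  have hclass : wordClass (fun i : Fin n => (f %ₘ (X ^ n - 1)).coeff i) =
      Ideal.Quotient.mk (Ideal.span {(X ^ n - 1 : F[X])}) f := by
    unfold wordClass
    rw [Fin.sum_univ_eq_sum_range (fun i => Polynomial.C ((f %ₘ (X ^ n - 1)).coeff i) * X ^ i) n,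
      ← as_sum_range_C_mul_X_pow' _ hdeg, Ideal.Quotient.eq, Ideal.mem_span_singleton]
    rw [modByMonic_eq_sub_mul_div f (X ^ n - 1)]
    exact ⟨-(f /ₘ (X ^ n - 1)), by ring⟩
  refine ⟨_, show wordClass _ ∈ C by rw [hclass]; exact hx, fun h => hx0 ?_⟩
  rw [← hclass, h]
  simp [wordClass]

theorem aeval_word_eq_zero {E : Type*} [Field E] [Algebra F E] {C : Ideal (CyclicRing F n)}
    {α : E} {c : Fin n → F} (hc : c ∈ words C) {k : ℕ} (hk : k ∈ definingSet C α) :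
    ∑ i : Fin n, algebraMap F E (c i) * (α ^ k) ^ (i : ℕ) = 0 := by
  have hdvd : preGenerator C ∣ ∑ i : Fin n, Polynomial.C (c i) * X ^ (i : ℕ) :=
    (Submodule.IsPrincipal.mem_iff_generator_dvd _).mp (show _ ∈ C.comap _ from hc)
  have hpre : aeval (α ^ k) (preGenerator C) = 0 := by
    have h := hk.2
    rw [generatorPoly, map_mul, aeval_C, mul_eq_zero] at h
    rcases h with h | h
    · have h0 : preGenerator C = 0 := by simpa using h
      rw [h0, map_zero]
    · exact h
  obtain ⟨q, hq⟩ := hdvd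
  have h := congrArg (aeval (α ^ k)) hq
  rw [map_mul, hpre, zero_mul] at h
  simpa using h

/-- Only the support of a minimum-weight word is kept as index set. The sum is not identically zero
by the Vandermonde argument, the powers α^i with i < n being distinct. -/
theorem exists_expSum_of_ne_bot (hn : 1 ≤ n) {E : Type*} [Field E] [Algebra F E] {α : E}
    (hα : IsPrimitiveRoot α n) {C : Ideal (CyclicRing F n)} (hC : C ≠ ⊥) :
    ∃ (ι : Type) (_ : Fintype ι) (γ β : ι → E), Fintype.card ι = distance C ∧
      (∀ i, β i ≠ 0) ∧ (∀ i, β i ^ n = 1) ∧ (∃ k, expSum γ β k ≠ 0) ∧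
      ∀ k : ℕ, k % n ∈ definingSet C α → expSum γ β k = 0 := by
  classical
  obtain ⟨c, hc, hc0, hw⟩ : distance C ∈ {w | ∃ c ∈ words C, c ≠ 0 ∧ weight c = w} := by
    obtain ⟨c, hc, hc0⟩ := exists_word_ne_zero hn hC
    exact Nat.sInf_mem ⟨_, c, hc, hc0, rfl⟩
  have hα0 : α ≠ 0 := hα.ne_zero (by omega)
  have hsum : ∀ k : ℕ, expSum (fun i : {i // c i ≠ 0} => algebraMap F E (c i))
      (fun i => α ^ (i : ℕ)) k = ∑ i : Fin n, algebraMap F E (c i) * (α ^ (i : ℕ)) ^ k := by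
    intro k
    unfold expSum
    simp only [zpow_natCast]
    rw [← Finset.sum_filter_of_ne (p := fun i => c i ≠ 0)
      (fun i _ h hi => h (by rw [hi, map_zero, zero_mul]))]
    exact (Finset.sum_subtype (Finset.univ.filter fun i => c i ≠ 0) (fun i => by simp)
      (fun i => algebraMap F E (c i) * (α ^ (i : ℕ)) ^ k)).symm
  refine ⟨{i // c i ≠ 0}, inferInstance, fun i => algebraMap F E (c i), fun i => α ^ (i : ℕ),
    ?_, fun i => pow_ne_zero _ hα0, fun i => ?_, ?_, fun k hk => ?_⟩
  · rw [← hw, weight, hammingNorm, Fintype.card_subtype]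
  · rw [← pow_mul, mul_comm, pow_mul, hα.pow_eq_one, one_pow]
  · by_contra! h
    refine hc0 (funext fun i => (algebraMap F E).injective ?_)
    have h2 := Matrix.eq_zero_of_forall_pow_sum_mul_pow_eq_zero
      (f := fun i : Fin n => α ^ (i : ℕ)) (v := fun i => algebraMap F E (c i))
      (fun i j hij => Fin.ext (hα.pow_inj i.2 j.2 hij))
      (fun j => by rw [← hsum]; exact h _)
    simpa using congrFun h2 i
  · rw [hsum, ← aeval_word_eq_zero hc hk]
    refine Finset.sum_congr rfl fun i _ => ?_
    rw [← pow_eq_pow_mod k hα.pow_eq_one, ← pow_mul, ← pow_mul, mul_comm k]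

end Words
end CyclicBound

theorem mainTheorem3 {F : Type*} [Field F] [Fintype F] (n : ℕ) (hn : 1 ≤ n)
    (hq : Nat.Coprime n (Fintype.card F))
    {E : Type*} [Field E] [Algebra F E] (α : E) (hα : IsPrimitiveRoot α n)
    (C : Ideal (CyclicBound.CyclicRing F n)) (hC : C ≠ ⊥)
    (ℓ m r s ρ : ℕ) (hm : 1 ≤ m) (hmℓ : m ≤ ℓ) (hs : 1 ≤ s) (hρ : 1 ≤ ρ)
    (hincl :
      CyclicBound.Included
          ((CyclicBound.zeros ℓ ++ CyclicBound.deltas r) ++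
            CyclicBound.pow (CyclicBound.zeros m ++ CyclicBound.deltas r) s)
          (CyclicBound.pow (CyclicBound.rootVector n (CyclicBound.definingSet C α)) ρ) ∨
        CyclicBound.Included
          (CyclicBound.pow (CyclicBound.deltas r ++ CyclicBound.zeros m) s ++
            (CyclicBound.deltas r ++ CyclicBound.zeros ℓ))
          (CyclicBound.pow (CyclicBound.rootVector n (CyclicBound.definingSet C α)) ρ)) :
    (Nat.gcd (m + r) n ≤ m →
      (CyclicBound.distance C : ℤ) ≥
        (ℓ : ℤ) + 1 + s - r * ((ℓ / (m + r) : ℕ) : ℤ)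
          - max (((ℓ % (m + r) : ℕ) : ℤ) - m) 0) ∧
    (¬ Nat.gcd (m + r) n ≤ m → CyclicBound.distance C ≥ ℓ + 1) ∧
    (∀ lam μ : ℕ, ℓ = lam * μ → m + 1 = μ → lam + 1 ≤ s → r = 1 →
      (¬ μ ∣ n →
        (CyclicBound.distance C : ℤ) ≥ (μ : ℤ) * lam + μ + s - lam - 1) ∧
      (μ ∣ n → CyclicBound.distance C ≥ μ * lam + μ)) := by
  obtain ⟨ι, _, γ, β, hcard, hβ, hβn, ⟨k₀, hk₀⟩, hz⟩ :=
    CyclicBound.exists_expSum_of_ne_bot hn hα hC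
  rw [← hcard]
  rcases hincl with h | h
  · obtain ⟨i, hi⟩ := CyclicBound.exists_shift_of_included hn h
    refine CyclicBound.pattern_bounds (γ := fun t => γ t * β t ^ (i : ℤ)) hβ hβn hn
      ⟨k₀ - i, by rwa [CyclicBound.expSum_add γ β hβ, add_sub_cancel]⟩ hm hmℓ
      (fun k hk hkℓ => ?_) (fun j b hj hb => ?_)
    · lift k to ℕ using hk
      rw [CyclicBound.expSum_add γ β hβ]
      exact_mod_cast hz (i + k)
        (hi k (CyclicBound.getElem?_forward_head _ (by exact_mod_cast hkℓ)))
    · rw [CyclicBound.expSum_add γ β hβ]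
      exact_mod_cast hz _ (hi _ (CyclicBound.getElem?_forward_block hj hb))
  · obtain ⟨i, hi⟩ := CyclicBound.exists_shift_of_included hn h
    -- Inverting β reads the sequence backwards. The origin is the last position of the pattern, i +
    -- (s(m + r) + r + ℓ) − 1, so the long block comes first.
    refine CyclicBound.pattern_bounds
      (γ := fun t => γ t * β t ^ ((i + (s * (m + r) + r + ℓ) : ℕ) - 1 : ℤ))
      (β := fun t => (β t)⁻¹) (fun t => inv_ne_zero (hβ t))
      (fun t => by rw [inv_pow, hβn, inv_one]) hn
      ⟨(i + (s * (m + r) + r + ℓ) : ℕ) - 1 - k₀, by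
        rwa [CyclicBound.expSum_sub γ β hβ, sub_sub_cancel]⟩ hm hmℓ
      (fun k hk hkℓ => ?_) (fun j b hj hb => ?_)
    · lift k to ℕ using hk
      rw [CyclicBound.expSum_sub γ β hβ]
      have hkℓ' : k < ℓ := by exact_mod_cast hkℓ
      have h1 := hz _ (hi _ (CyclicBound.getElem?_backward_head (m := m) (r := r) (s := s)
        (show ℓ - 1 - k < ℓ by omega)))
      convert h1 using 2
      omega
    · rw [CyclicBound.expSum_sub γ β hβ]
      have h1 := hz _ (hi _ (CyclicBound.getElem?_backward_block (m := m) (r := r) (s := s)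
        (j := s - 1 - j) (b := m - 1 - b) (CyclicBound.deltas r ++ CyclicBound.zeros ℓ)
        (by omega) (by omega)))
      obtain ⟨u, rfl⟩ : ∃ u, s = u + j + 1 := ⟨s - 1 - j, by omega⟩
      obtain ⟨v, rfl⟩ : ∃ v, m = v + b + 1 := ⟨m - 1 - b, by omega⟩
      rw [show u + j + 1 - 1 - j = u by omega, show v + b + 1 - 1 - b = v by omega] at h1
      convert h1 using 2
      push_cast
      ring
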